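/- **Proposition 2.2.** Fix a constant integer $k\ge 3$. For $m\ge 1$ let $X$ be the $m\times km$ variable matrix whose columns are the vector variables $X^j_i$ ($1\le j\le k$, $1\le i\le m$), let $n=km^2$ be the number of its entries, and let $$E(X)=\prod_{\sigma:\{1,\dots,m\}\to\{1,\dots,k\}}\det{}_\sigma(X),$$ where $\det_\sigma(X)$ is the determinant of the $m\times m$ matrix whose $i$-th column is $X^{\sigma(i)}_i$. Fix a real constant $a>1$, let $q=q(n)$ be primes with $q=O(\mathrm{poly}(n))$, put $l=n^a$ (rounded down where this is not an integer) and $p=q^l$, and let $F_p$ be the field with $p$ elements. Suppose that for every choice of exponents $r=r(m)$ with $0<r<p$ (for all $m\ge1$) the functions $F_p^{\,n}\to F_p$ defined by $E(X)^r$, $m=1,2,\dots$, are not computed by any family of arithmetic circuits over $F_p$ whose size (the total number of nodes) is polynomially bounded in $n$. Then $NP\not\subseteq P/\mathrm{poly}$. Here $NP$ is the class of languages over $\{0,1\}$ that have deterministic polynomial-time verifiers with certificates of polynomial length, and $P/\mathrm{poly}$ is the class of languages over $\{0,1\}$ decided by families of boolean circuits of polynomial size. -/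

import Mathlib

/-! ### Arithmetic circuits -/

/-- The possible nodes with number `i` of an arithmetic circuit over `F` with input variables `ι`:
an input variable, a constant, or the sum or the product of the values of two earlier nodes. -/
inductive ArithNode (F ι : Type) (i : ℕ) : Type
  | input (v : ι)
  | const (c : F)
  | add (j k : Fin i)
  | mul (j k : Fin i)

/-- An arithmetic circuit over `F` with input variables `ι`: a directed acyclic graph (of unbounded
fan-out), given by its nodes in topological order, together with an output node. Its size is the
total number of nodes. -/
structure ArithCircuit (F ι : Type) where
  size : ℕ
  node : (i : Fin size) → ArithNode F ι i
  output : Fin size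

namespace ArithCircuit

variable {F ι : Type} [CommSemiring F]

/-- The value of node `i` on input `x`. -/
def value (C : ArithCircuit F ι) (x : ι → F) (i : Fin C.size) : F :=
  match C.node i with
  | .input v => x v
  | .const c => c
  | .add j k =>
      C.value x ⟨j, j.isLt.trans i.isLt⟩ + C.value x ⟨k, k.isLt.trans i.isLt⟩
  | .mul j k =>
      C.value x ⟨j, j.isLt.trans i.isLt⟩ * C.value x ⟨k, k.isLt.trans i.isLt⟩
termination_by i.val
decreasing_by all_goals exact Fin.isLt _

/-- The value of the output node on input `x`. -/
def eval (C : ArithCircuit F ι) (x : ι → F) : F := C.value x C.output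

/-- The circuit computes the function that the polynomial `f` defines on `F`-valued inputs. -/
def Computes (C : ArithCircuit F ι) (f : MvPolynomial ι F) : Prop :=
  ∀ x : ι → F, C.eval x = MvPolynomial.eval x f

end ArithCircuit

/-! ### Boolean circuits and the class P/poly -/

/-- The possible nodes with number `i` of a boolean circuit with `n` input bits. -/
inductive BoolNode (n i : ℕ) : Type
  | input (v : Fin n)
  | const (b : Bool)
  | not (j : Fin i)
  | and (j k : Fin i)
  | or (j k : Fin i)

/-- A boolean circuit with `n` input bits: a directed acyclic graph (of unbounded fan-out), given by
its nodes in topological order, together with an output node. Its size is the total number of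
nodes. -/
structure BoolCircuit (n : ℕ) where
  size : ℕ
  node : (i : Fin size) → BoolNode n i
  output : Fin size

namespace BoolCircuit

variable {n : ℕ}

/-- The value of node `i` on input `x`. -/
def value (C : BoolCircuit n) (x : Fin n → Bool) (i : Fin C.size) : Bool :=
  match C.node i with
  | .input v => x v
  | .const b => b
  | .not j => !(C.value x ⟨j, j.isLt.trans i.isLt⟩)
  | .and j k =>
      C.value x ⟨j, j.isLt.trans i.isLt⟩ && C.value x ⟨k, k.isLt.trans i.isLt⟩
  | .or j k =>
      C.value x ⟨j, j.isLt.trans i.isLt⟩ || C.value x ⟨k, k.isLt.trans i.isLt⟩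
termination_by i.val
decreasing_by all_goals exact Fin.isLt _

/-- The value of the output node on input `x`. -/
def eval (C : BoolCircuit n) (x : Fin n → Bool) : Bool := C.value x C.output

end BoolCircuit

/-- `P/poly`: the languages decided by boolean circuit families of polynomial size. -/
def PPoly : Set (Language Bool) :=
  {L | ∃ c : ℕ, ∀ n : ℕ, ∃ C : BoolCircuit n, C.size ≤ n ^ c + c ∧
    ∀ x : Fin n → Bool, C.eval x = true ↔ List.ofFn x ∈ L}

/-! ### The class NP -/

/-- `V` is computed in polynomial time by a deterministic machine, which reads the pair `(x, w)` as
the word `x` followed by the word `w`, over two disjoint copies of the alphabet `{0, 1}`. -/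
def IsPolyTimeVerifier (V : List Bool × List Bool → Bool) : Prop :=
  Nonempty (Turing.TM2ComputableInPolyTime
    (Computability.encodingProd
      (Computability.encodingList Bool) (Computability.encodingList Bool)).encode
    Computability.encodingBoolBool.encode V)

/-- `NP`: the languages with a deterministic polynomial-time verifier for certificates of
polynomial length. -/
def NP : Set (Language Bool) :=
  {L | ∃ (V : List Bool × List Bool → Bool) (c : ℕ), IsPolyTimeVerifier V ∧
    ∀ x : List Bool, x ∈ L ↔ ∃ w : List Bool, w.length ≤ x.length ^ c + c ∧ V (x, w) = true}

/-! ### The polynomial `E(X)` and the stronger conjecture -/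

/-- The entries of the `m × km` variable matrix `X`: `(a, (j, i))` stands for the `a`-th coordinate
of the vector variable `X^j_i`, which is a column of `X`. -/
abbrev EVar (k m : ℕ) : Type := Fin m × (Fin k × Fin m)

/-- `det_σ(X)`, the determinant of the `m × m` matrix whose `i`-th column is `X^{σ(i)}_i`. -/
noncomputable def detSigma (F : Type) [Field F] (k m : ℕ) (σ : Fin m → Fin k) :
    MvPolynomial (EVar k m) F :=
  (Matrix.of fun a i : Fin m => MvPolynomial.X (R := F) ((a, (σ i, i)) : EVar k m)).det

/-- `E(X) = ∏_σ det_σ(X)`, over all functions `σ : {1, …, m} → {1, …, k}`. -/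
noncomputable def EPoly (F : Type) [Field F] (k m : ℕ) : MvPolynomial (EVar k m) F :=
  ∏ σ : Fin m → Fin k, detSigma F k m σ

/-- `n = k m²`, the number of entries of `X`. -/
def entryCount (k m : ℕ) : ℕ := k * m ^ 2

/-- `l = n ^ a`, rounded down where `n ^ a` is not an integer. -/
noncomputable def extDegree (a : ℝ) (n : ℕ) : ℕ := ⌊(n : ℝ) ^ a⌋₊

/-- `f(n) = O(poly(n))`. -/
def PolyBounded (f : ℕ → ℕ) : Prop := ∃ c : ℕ, ∀ n : ℕ, f n ≤ n ^ c + c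

/-- The stronger form of the `NP ⊄ P/poly` conjecture, for a constant number `k`, a constant
exponent `a` and primes `q = q(n)`: over the field with `p = q ^ l` elements, `l = n ^ a`, for no
choice of exponents `0 < r < p` is `E(X) ^ r` computed by arithmetic circuits of size `poly(n)`. -/
def StrongerConjecture (k : ℕ) (a : ℝ) (q : ℕ → ℕ) [∀ n, Fact (q n).Prime] : Prop :=
  ∀ r : ℕ → ℕ,
    (∀ m, 1 ≤ m → 0 < r m ∧
      r m < q (entryCount k m) ^ extDegree a (entryCount k m)) →
    ¬ ∃ c : ℕ, ∀ m, 1 ≤ m →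
      ∃ C : ArithCircuit
          (GaloisField (q (entryCount k m)) (extDegree a (entryCount k m))) (EVar k m),
        C.size ≤ entryCount k m ^ c + c ∧ C.Computes (EPoly _ k m ^ r m)

/-!
The contrapositive is proved: circuits of polynomial size for a single language in `NP` give small
arithmetic circuits for `E(X) ^ (p - 1)`. This power is the function that is `0` where `E` vanishes
and `1` elsewhere, so the task is to decide whether `E(X) = 0`.

*The language.* `cnfSat` is satisfiability of formulas in conjunctive normal form, written so that
each clause says about every variable in turn whether it or its negation occurs. A stack machine
checks an assignment by walking along it once per clause (`isPolyTimeVerifier_cnfVerifier`).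

*From `E` to a formula.* `E(X) = 0` says that some matrix with columns `X^{σ(i)}_i` kills a nonzero
vector. In coordinates over the prime field, with the trace form used to test for zero, this becomes
a linear system over `F_q` whose unknowns are indexed by `j`, `i` and a coordinate, and where for
each `i` only one `j` may carry nonzero entries (`solvable_traceCoeff_iff`). Since `q` is
polynomially bounded, elements of `F_q` can be coded in unary, and the system is expressed by a
formula about the values of the unknowns and of all partial sums
(`LinearSystem.exists_satisfies_iff`). Only the bits that test whether `t * Y = d`, for some
coefficient `Y` of the system, depend on `X`.

*Back to arithmetic circuits.* The coefficients are traces `Tr(c * x)` of multiples of entries of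
`X`; such a trace is the sum of `l` iterated `q`-th powers, and `1 - (y - t) ^ (q - 1)` tests
equality in `F_q`. So each bit of the formula is computed by a small arithmetic circuit
(`CircuitComputable.trace_eq`), on top of which the boolean circuit for `cnfSat` is simulated
(`CircuitComputable.boolCircuit`). The sequences `q` and `l` need not be computable, because they
enter only through the constants and the shape of the circuits.
-/

/-! ### A verifier for satisfiability of formulas in conjunctive normal form -/

/-- Evaluation of a formula, read as a word two bits at a time, under an assignment given as a word.
The pair `(true, true)` ends a clause. Any other pair `(p, q)` is about the next variable: `p` says
that it occurs in the clause, `q` that its negation does. Variables beyond the end of the assignment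
are false. In `cnfRun f w b ok sat`, the word `f` is what remains of the formula, `w` and `b` are the
unread part and the reversed read part of the assignment, `ok` tells whether all completed clauses
hold, `sat` whether the current clause already holds. -/
def cnfRun : List Bool → List Bool → List Bool → Bool → Bool → Bool
  | p :: q :: f, w, b, ok, sat =>
    if p && q then cnfRun f (b.reverse ++ w) [] (ok && sat) false
    else match w with
      | [] => cnfRun f [] b ok (sat || q)
      | c :: w => cnfRun f w (c :: b) ok (sat || (p && c || q && !c))
  | _, _, _, ok, _ => ok

/-- The verifier for satisfiability: the formula is written in reverse, so that reading it from the
input onto a stack puts its beginning on top. -/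
def cnfVerifier (y : List Bool × List Bool) : Bool := cnfRun y.1.reverse y.2 [] true false

namespace CnfMachine

/-- The stacks: the input, of which in the end only the assignment is left; the rest of the formula;
the reversed read part of the assignment. -/
inductive Stack
  | input | formula | back
  deriving DecidableEq

instance : Fintype Stack := ⟨{.input, .formula, .back}, by rintro ⟨⟩ <;> simp⟩

/-- The stack alphabets. -/
abbrev Alphabet : Stack → Type
  | .input => Bool ⊕ Bool
  | .formula => Bool
  | .back => Bool

/-- The control labels: moving the formula to its own stack, reading the formula, rewinding the
assignment, and clearing all stacks. -/
inductive Label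
  | load | read | rewind | clear
  deriving DecidableEq

instance : Fintype Label := ⟨{.load, .read, .rewind, .clear}, by rintro ⟨⟩ <;> simp⟩

/-- The internal memory: the accumulators `ok` and `sat` of `cnfRun` and three registers for
symbols just popped. -/
structure Memory where
  ok : Bool
  sat : Bool
  sym : Option (Bool ⊕ Bool)
  fst : Option Bool
  snd : Option Bool
  deriving Fintype

/-- The initial memory. -/
def Memory.start : Memory := ⟨true, false, none, none, none⟩

/-- The bit of a symbol, and `false` for an empty stack. -/
def symBit : Option (Bool ⊕ Bool) → Bool
  | some (.inl b) => b
  | some (.inr b) => b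
  | none => false

/-- The update of `sat` by the pair of bits and the assignment bit in the registers. -/
def Memory.updateSat (s : Memory) : Memory :=
  { s with sat := s.sat || (s.fst.getD false && symBit s.sym || s.snd.getD false && !symBit s.sym) }

/-- The update of `ok` and `sat` at the end of a clause. -/
def Memory.endClause (s : Memory) : Memory := { s with ok := s.ok && s.sat, sat := false }

open Turing.TM2.Stmt in
/-- The program. -/
def program : Label → Turing.TM2.Stmt Alphabet Label Memory
  | .load =>
    pop .input (fun s o => { s with sym := o }) <|
    branch (fun s => (s.sym.map Sum.isLeft).getD false)
      (push .formula (fun s => symBit s.sym) <| goto fun _ => .load)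
      (branch (fun s => s.sym.isSome)
        (push .input (fun s => .inr (symBit s.sym)) <| goto fun _ => .read)
        (goto fun _ => .read))
  | .read =>
    pop .formula (fun s o => { s with fst := o }) <|
    pop .formula (fun s o => { s with snd := o }) <|
    branch (fun s => s.snd.isNone) (goto fun _ => .clear) <|
    branch (fun s => s.fst.getD false && s.snd.getD false)
      (load Memory.endClause <| goto fun _ => .rewind) <|
    pop .input (fun s o => { s with sym := o }) <|
    load Memory.updateSat <|
    branch (fun s => s.sym.isSome)
      (push .back (fun s => symBit s.sym) <| goto fun _ => .read)
      (goto fun _ => .read)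
  | .rewind =>
    pop .back (fun s o => { s with fst := o }) <|
    branch (fun s => s.fst.isSome)
      (push .input (fun s => .inr (s.fst.getD false)) <| goto fun _ => .rewind)
      (goto fun _ => .read)
  | .clear =>
    pop .input (fun s o => { s with sym := o }) <|
    pop .back (fun s o => { s with fst := o }) <|
    branch (fun s => s.sym.isNone && s.fst.isNone)
      (push .formula (fun s => s.ok) <| load (fun _ => Memory.start) halt)
      (goto fun _ => .clear)

/-- The contents of the three stacks as a function. -/
def contents (i : List (Bool ⊕ Bool)) (f b : List Bool) : (k : Stack) → List (Alphabet k)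
  | .input => i
  | .formula => f
  | .back => b

variable (i i' : List (Bool ⊕ Bool)) (f f' b b' : List Bool)

@[simp] theorem update_input : Function.update (contents i f b) .input i' = contents i' f b := by
  funext k; cases k <;> rfl

@[simp] theorem update_formula :
    Function.update (contents i f b) .formula f' = contents i f' b := by
  funext k; cases k <;> rfl

@[simp] theorem update_back : Function.update (contents i f b) .back b' = contents i f b' := by
  funext k; cases k <;> rfl

@[simp] theorem contents_input : contents i f b .input = i := rfl
@[simp] theorem contents_formula : contents i f b .formula = f := rfl
@[simp] theorem contents_back : contents i f b .back = b := rfl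

/-- The configurations of the machine. -/
abbrev Config := Turing.TM2.Cfg Alphabet Label Memory

/-- `ReachesIn c d t`: the machine gets from `c` to `d` in at most `t` steps. -/
def ReachesIn (c d : Config) (t : ℕ) : Prop :=
  ∃ n ≤ t, (flip bind (Turing.TM2.step program))^[n] (some c) = some d

variable {i i' f f' b b'}

theorem ReachesIn.head {c c' d : Config} {t : ℕ} (h : Turing.TM2.step program c = some c')
    (h' : ReachesIn c' d t) : ReachesIn c d (t + 1) := by
  obtain ⟨n, hn, e⟩ := h'
  refine ⟨n + 1, by omega, ?_⟩
  rw [Function.iterate_succ_apply]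
  change (flip bind (Turing.TM2.step program))^[n] (Turing.TM2.step program c) = _
  rw [h, e]

theorem ReachesIn.mono {c d : Config} {t t' : ℕ} (h : ReachesIn c d t) (ht : t ≤ t') :
    ReachesIn c d t' := by
  obtain ⟨n, hn, e⟩ := h
  exact ⟨n, hn.trans ht, e⟩

/-- The halting configuration with output `r`. -/
def final (r : Bool) : Config := ⟨none, Memory.start, contents [] [r] []⟩

theorem reaches_clear (i : List (Bool ⊕ Bool)) (b : List Bool) (s : Memory) :
    ReachesIn ⟨some .clear, s, contents i [] b⟩ (final s.ok) (i.length + b.length + 1) := by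
  induction h : i.length + b.length using Nat.strong_induction_on generalizing i b s with
  | _ n ih =>
    subst h
    have step : ∀ s' : Memory, s'.ok = s.ok → i.length + b.length ≠ 0 →
        ReachesIn ⟨some .clear, s', contents i.tail [] b.tail⟩ (final s.ok)
          (i.length + b.length) := by
      intro s' hs' hne
      rw [← hs']
      refine (ih _ ?_ i.tail b.tail s' rfl).mono ?_ <;>
        simp only [List.length_tail] <;> omega
    rcases i with _ | ⟨x, i⟩
    · rcases b with _ | ⟨y, b⟩
      · exact ⟨1, by simp, by simp [flip, program, final]⟩
      · exact (step { s with sym := none, fst := some y } rfl (by simp)).head (by simp [program])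
    · exact (step { s with sym := some x, fst := b.head? } rfl (by simp)).head (by simp [program])

theorem ReachesIn.rewind {w : List Bool} {t : ℕ} {d : Config} {ok sat : Bool}
    (h : ∀ s : Memory, s.ok = ok → s.sat = sat →
      ReachesIn ⟨some .read, s, contents ((b.reverse ++ w).map .inr) f []⟩ d t)
    (s : Memory) (hok : s.ok = ok) (hsat : s.sat = sat) :
    ReachesIn ⟨some .rewind, s, contents (w.map .inr) f b⟩ d (t + b.length + 1) := by
  induction b generalizing s w with
  | nil =>
    exact (h { s with fst := none } hok hsat).head (by simp [program])
  | cons c b ih =>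
    refine (ih (w := c :: w) ?_ { s with fst := some c } hok hsat).head (by simp [program])
    simpa using h

/-- Each pair of bits costs one step for reading it and at most `w.length + b.length + 1` steps for
rewinding the assignment. -/
theorem reaches_read (f w b : List Bool) (s : Memory) :
    ReachesIn ⟨some .read, s, contents (w.map .inr) f b⟩ (final (cnfRun f w b s.ok s.sat))
      ((f.length + 1) * (w.length + b.length + 2)) := by
  induction h : f.length using Nat.strong_induction_on generalizing f w b s with
  | _ n ih =>
    subst h
    rcases f with _ | ⟨p, _ | ⟨q, f⟩⟩
    · refine ((reaches_clear (w.map .inr) b { s with fst := none, snd := none }).head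
        (by simp [program])).mono ?_
      simp
    · refine ((reaches_clear (w.map .inr) b { s with fst := some p, snd := none }).head
        (by simp [program])).mono ?_
      simp
    · have key := ih f.length (by simp) f
      by_cases hpq : p = true ∧ q = true
      · obtain ⟨rfl, rfl⟩ := hpq
        have hr := ReachesIn.rewind (f := f) (b := b) (w := w) (ok := s.ok && s.sat) (sat := false)
          (t := (f.length + 1) * (w.length + b.length + 2))
          (d := final (cnfRun f (b.reverse ++ w) [] (s.ok && s.sat) false)) (by
            intro s' h1 h2
            have := key (b.reverse ++ w) [] s' rfl
            rw [h1, h2] at this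
            refine this.mono (le_of_eq ?_)
            simp [Nat.add_comm])
          (Memory.endClause { s with fst := some true, snd := some true }) rfl rfl
        refine (hr.head (by simp [program])).mono ?_
        simp; nlinarith
      · have hpq' : (p && q) = false := by simpa using hpq
        rcases w with _ | ⟨c, w⟩
        · have := key [] b
            (Memory.updateSat { s with fst := some p, snd := some q, sym := none }) rfl
          have e : cnfRun (p :: q :: f) [] b s.ok s.sat = cnfRun f [] b s.ok (s.sat || q) := by
            simp [cnfRun, hpq']
          rw [e]
          simp only [Memory.updateSat, symBit, Bool.not_false, Bool.and_true, Bool.and_false,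
            Option.getD_some, Bool.false_or] at this
          refine (this.head (by simp [program, hpq', Memory.updateSat, symBit])).mono ?_
          simp
        · have := key w (c :: b)
            (Memory.updateSat { s with fst := some p, snd := some q, sym := some (.inr c) }) rfl
          have e : cnfRun (p :: q :: f) (c :: w) b s.ok s.sat =
              cnfRun f w (c :: b) s.ok (s.sat || (p && c || q && !c)) := by
            simp [cnfRun, hpq']
          rw [e]
          refine (this.head (by simp [program, hpq', Memory.updateSat, symBit])).mono ?_
          simp; nlinarith

theorem reaches_load (x w f : List Bool) (s : Memory) :
    ReachesIn ⟨some .load, s, contents (x.map .inl ++ w.map .inr) f []⟩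
      (final (cnfRun (x.reverse ++ f) w [] s.ok s.sat))
      (x.length + 1 + (x.length + f.length + 1) * (w.length + 2)) := by
  induction x generalizing f s with
  | nil =>
    rcases w with _ | ⟨c, w⟩
    · refine (ReachesIn.head (by simp [program])
        (reaches_read f [] [] { s with sym := none })).mono ?_
      simp
    · refine (ReachesIn.head (by simp [program, symBit])
        (reaches_read f (c :: w) [] { s with sym := some (.inr c) })).mono ?_
      simp
  | cons a x ih =>
    refine (ReachesIn.head (by simp [program, symBit]; rfl)
      (by simpa using ih (a :: f) { s with sym := some (.inl a) })).mono ?_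
    simp; ring_nf; omega

/-- The bundled machine; the output appears on the stack that held the formula. -/
def machine : Turing.FinTM2 where
  K := Stack
  k₀ := .input
  k₁ := .formula
  Γ := Alphabet
  Λ := Label
  main := .load
  σ := Memory
  initialState := Memory.start
  Γk₀Fin := inferInstanceAs (Fintype (Bool ⊕ Bool))
  m := program

end CnfMachine

open CnfMachine in
theorem isPolyTimeVerifier_cnfVerifier : IsPolyTimeVerifier cnfVerifier := by
  have key : ∀ y : List Bool × List Bool, ∃ n : ℕ,
      n ≤ ((Polynomial.X + 2) ^ 2 + Polynomial.X : Polynomial ℕ).eval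
        ((Computability.encodingProd (Computability.encodingList Bool)
          (Computability.encodingList Bool)).encode y).length ∧
      (flip bind (Turing.TM2.step program))^[n] (some (Turing.initList machine
        ((Computability.encodingProd (Computability.encodingList Bool)
          (Computability.encodingList Bool)).encode y) : Config)) =
        some (Turing.haltList machine [cnfVerifier y] : Config) := by
    rintro ⟨x, w⟩
    have h := (reaches_load x w [] Memory.start).mono
      (t' := ((Polynomial.X + 2) ^ 2 + Polynomial.X : Polynomial ℕ).eval
        ((Computability.encodingProd (Computability.encodingList Bool)
          (Computability.encodingList Bool)).encode (x, w)).length) (by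
        simp [Computability.encodingProd, Computability.encodingList]
        nlinarith)
    have h0 : (Turing.initList machine ((Computability.encodingProd (Computability.encodingList Bool)
          (Computability.encodingList Bool)).encode (x, w)) : Config) =
        ⟨some .load, Memory.start, contents (x.map .inl ++ w.map .inr) [] []⟩ := by
      simp only [Turing.initList]
      congr 1
      funext k; cases k <;> rfl
    have h1 : (Turing.haltList machine [cnfVerifier (x, w)] : Config) =
        final (cnfVerifier (x, w)) := by
      simp only [Turing.haltList, final]
      congr 1
      funext k; cases k <;> rfl
    rw [h0, h1]
    rw [List.append_nil] at h
    exact h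
  choose n hn hsteps using key
  refine ⟨{
    tm := machine
    inputAlphabet := Equiv.refl _
    outputAlphabet := Equiv.refl _
    time := (Polynomial.X + 2) ^ 2 + Polynomial.X
    outputsFun := fun y => ⟨⟨n y, ?_⟩, hn y⟩ }⟩
  exact (congrArg (fun z => (flip bind machine.step)^[n y] (some (Turing.initList machine z)))
    (List.map_id _)).trans (hsteps y)

/-- Satisfiability of formulas in conjunctive normal form, encoded as in `cnfVerifier`. -/
def cnfSat : Language Bool :=
  {x | ∃ w : List Bool, w.length ≤ x.length ^ 1 + 1 ∧ cnfVerifier (x, w) = true}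

theorem cnfSat_mem_NP : cnfSat ∈ NP :=
  ⟨cnfVerifier, 1, isPolyTimeVerifier_cnfVerifier, fun _ => Iff.rfl⟩

/-- The part of a formula that encodes one clause, with `t` for the bit `true`. -/
def clauseWord {A : Type} (t : A) (r : List (A × A)) : List A :=
  r.flatMap (fun c => [c.1, c.2]) ++ [t, t]

/-- The word for the formula with clauses `Fin R` and variables `Fin N`; `P r c` tells whether the
variable `c` occurs in the clause `r`, and `Q r c` whether its negation does. The bits may be
elements of any type `A`, with `t` for the bit `true`; taking bits that depend on a parameter one
obtains a formula that depends on a parameter. -/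
def cnfWord {A : Type} (t : A) {R N : ℕ} (P Q : Fin R → Fin N → A) : List A :=
  (List.ofFn fun r => List.ofFn fun c => (P r c, Q r c)).flatMap (clauseWord t)

section cnfWord

variable {A B : Type} {R N : ℕ}

theorem length_cnfWord (t : A) (P Q : Fin R → Fin N → A) :
    (cnfWord t P Q).length = R * (2 * N + 2) := by
  have h : ∀ r : List (A × A), (clauseWord t r).length = 2 * r.length + 2 := by
    intro r
    induction r with
    | nil => rfl
    | cons c r ih => simp [clauseWord] at ih ⊢; omega
  simp [cnfWord, List.length_flatMap, h, Function.comp_def, List.map_ofFn]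

theorem map_cnfWord (f : A → B) (t : A) (P Q : Fin R → Fin N → A) :
    (cnfWord t P Q).map f = cnfWord (f t) (fun r c => f (P r c)) (fun r c => f (Q r c)) := by
  simp [cnfWord, clauseWord, List.map_flatMap, List.ofFn_eq_map, List.flatMap_map]

theorem mem_cnfWord {t : A} {P Q : Fin R → Fin N → A} {g : A} (h : g ∈ cnfWord t P Q) :
    g = t ∨ ∃ r c, g = P r c ∨ g = Q r c := by
  simp only [cnfWord, clauseWord, List.mem_flatMap, List.mem_ofFn,
    List.mem_append, List.mem_cons, List.not_mem_nil, or_false] at h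
  obtain ⟨_, ⟨r, rfl⟩, ⟨p, hp, hg⟩ | hg⟩ := h
  · obtain ⟨c, rfl⟩ := List.mem_ofFn.1 hp
    exact .inr ⟨r, c, hg⟩
  · exact .inl (by tauto)

end cnfWord

/-- The value of a clause under an assignment, with missing variables false. -/
def clauseHolds : List (Bool × Bool) → List Bool → Bool
  | [], _ => false
  | c :: r, w => (c.1 && w.headD false || c.2 && !w.headD false) || clauseHolds r w.tail

theorem clauseHolds_ofFn {N : ℕ} (p : Fin N → Bool × Bool) (w : List Bool) :
    clauseHolds (List.ofFn p) w = true ↔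
      ∃ c, (p c).1 = true ∧ w.getD c false = true ∨ (p c).2 = true ∧ w.getD c false = false := by
  induction N generalizing w with
  | zero => simp [clauseHolds]
  | succ N ih =>
    have h1 : w.headD false = w.getD 0 false := by cases w <;> rfl
    have h2 : ∀ i, w.tail.getD i false = w.getD (i + 1) false := by
      intro i; cases w <;> simp
    rw [List.ofFn_succ, clauseHolds, Fin.exists_fin_succ]
    simp only [Bool.or_eq_true, ih, h1, h2, Bool.and_eq_true, Bool.not_eq_true', Fin.val_zero,
      Fin.val_succ]

/-- At the end of a clause the assignment is restored. -/
theorem cnfRun_clauseWord (r : List (Bool × Bool)) (hr : ∀ c ∈ r, (c.1 && c.2) = false)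
    (f w b : List Bool) (ok sat : Bool) :
    cnfRun (clauseWord true r ++ f) w b ok sat =
      cnfRun f (b.reverse ++ w) [] (ok && (sat || clauseHolds r w)) false := by
  induction r generalizing w b sat with
  | nil => simp [clauseWord, clauseHolds, cnfRun]
  | cons c r ih =>
    have hc : (c.1 && c.2) = false := hr c (by simp)
    replace ih := ih fun c hc => hr c (by simp [hc])
    have e : clauseWord true (c :: r) ++ f = c.1 :: c.2 :: (clauseWord true r ++ f) := by
      simp [clauseWord]
    rw [e]
    rcases w with _ | ⟨d, w⟩
    · simp [cnfRun, hc, ih, clauseHolds, Bool.or_assoc]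
    · simp [cnfRun, hc, ih, clauseHolds, Bool.or_assoc]

theorem cnfRun_flatMap (rows : List (List (Bool × Bool)))
    (h : ∀ r ∈ rows, ∀ c ∈ r, (c.1 && c.2) = false) (w : List Bool) (ok : Bool) :
    cnfRun (rows.flatMap (clauseWord true)) w [] ok false =
      (ok && rows.all fun r => clauseHolds r w) := by
  induction rows generalizing ok with
  | nil => simp [cnfRun]
  | cons r rows ih =>
    rw [List.flatMap_cons, cnfRun_clauseWord r (h r (by simp)), List.reverse_nil, List.nil_append,
      ih fun r hr => h r (by simp [hr])]
    simp [Bool.and_assoc]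

/-- The assignment `v` satisfies the formula with clauses `κ` and variables `V` in which the
literals of `r` are the `c` with `P r c` and the negations of the `c` with `Q r c`. -/
def Satisfies {κ V : Type} (P Q : κ → V → Bool) (v : V → Bool) : Prop :=
  ∀ r, ∃ c, P r c = true ∧ v c = true ∨ Q r c = true ∧ v c = false

/-- The number of variables is at most the length of the formula, so that the bound on the length of
certificates in `cnfSat` is no restriction once there is a clause. -/
theorem reverse_cnfWord_mem_cnfSat {R N : ℕ} (hR : 0 < R) (P Q : Fin R → Fin N → Bool)
    (h : ∀ r c, (P r c && Q r c) = false) :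
    (cnfWord true P Q).reverse ∈ cnfSat ↔ ∃ v, Satisfies P Q v := by
  have key : ∀ w : List Bool, cnfVerifier ((cnfWord true P Q).reverse, w) = true ↔
      Satisfies P Q fun c => w.getD c false := by
    intro w
    have := cnfRun_flatMap (List.ofFn fun r => List.ofFn fun c => (P r c, Q r c))
      (by simpa [List.forall_mem_ofFn_iff] using h) w true
    rw [cnfVerifier, List.reverse_reverse, cnfWord, this]
    simp [List.all_eq_true, clauseHolds_ofFn, Satisfies]
  constructor
  · rintro ⟨w, -, hw⟩
    exact ⟨_, (key w).1 hw⟩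
  · rintro ⟨v, hv⟩
    refine ⟨List.ofFn v, ?_, (key _).2 ?_⟩
    · have := Nat.mul_le_mul_right (2 * N + 2) hR
      simp [length_cnfWord]
      omega
    · simpa using hv

/-! ### Straight-line programs -/

section StraightLine

variable {F ι : Type}

/-- The value of a node, given the values of the earlier nodes. -/
def ArithNode.valueFrom [CommSemiring F] {i : ℕ} (nd : ArithNode F ι i) (x : ι → F)
    (val : Fin i → F) : F :=
  match nd with
  | .input v => x v
  | .const c => c
  | .add j k => val j + val k
  | .mul j k => val j * val k

theorem ArithCircuit.value_eq [CommSemiring F] (C : ArithCircuit F ι) (x : ι → F)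
    (i : Fin C.size) : C.value x i =
      (C.node i).valueFrom x fun j => C.value x ⟨j, j.isLt.trans i.isLt⟩ := by
  rw [ArithCircuit.value]
  cases C.node i <;> rfl

/-- The function `f` can be the next node of an arithmetic circuit with nodes computing `S`. -/
def NextNode [CommSemiring F] (S : List ((ι → F) → F)) (f : (ι → F) → F) : Prop :=
  (∃ v, f = fun x => x v) ∨ (∃ c, f = fun _ => c) ∨
    (∃ g ∈ S, ∃ h ∈ S, f = g + h) ∨ ∃ g ∈ S, ∃ h ∈ S, f = g * h

theorem NextNode.mono [CommSemiring F] {S T : List ((ι → F) → F)} (h : S ⊆ T) {f : (ι → F) → F} :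
    NextNode S f → NextNode T f := by
  rintro (hv | hc | ⟨g, hg, k, hk, e⟩ | ⟨g, hg, k, hk, e⟩)
  · exact .inl hv
  · exact .inr (.inl hc)
  · exact .inr (.inr (.inl ⟨g, h hg, k, h hk, e⟩))
  · exact .inr (.inr (.inr ⟨g, h hg, k, h hk, e⟩))

/-- The lists of the functions computed by the successive nodes of arithmetic circuits. -/
inductive IsStraightLine [CommSemiring F] : List ((ι → F) → F) → Prop
  | nil : IsStraightLine []
  | snoc {L f} : IsStraightLine L → NextNode L f → IsStraightLine (L ++ [f])

theorem IsStraightLine.append [CommSemiring F] {L M : List ((ι → F) → F)} (hL : IsStraightLine L)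
    (hM : IsStraightLine M) : IsStraightLine (L ++ M) := by
  induction hM with
  | nil => simpa using hL
  | snoc _ hf ih =>
    rw [← List.append_assoc]
    exact ih.snoc (hf.mono (List.subset_append_right _ _))

theorem IsStraightLine.nextNode_take [CommSemiring F] {L : List ((ι → F) → F)}
    (hL : IsStraightLine L) (i : ℕ) (hi : i < L.length) : NextNode (L.take i) L[i] := by
  induction hL with
  | nil => simp at hi
  | @snoc L f _ hf ih =>
    rcases Nat.lt_or_ge i L.length with h | h
    · rw [List.getElem_append_left h, List.take_append_of_le_length h.le]
      exact ih h
    · obtain rfl : i = L.length := by simp at hi; omega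
      simpa using hf

theorem IsStraightLine.exists_circuit [CommSemiring F] {L : List ((ι → F) → F)}
    (hL : IsStraightLine L) {f : (ι → F) → F} (hf : f ∈ L) :
    ∃ C : ArithCircuit F ι, C.size = L.length ∧ C.eval = f := by
  have mem_take : ∀ (i : Fin L.length) (g : (ι → F) → F), g ∈ L.take i → ∃ j : Fin i,
      L.get ⟨j, j.isLt.trans i.isLt⟩ = g := by
    intro i g hg
    obtain ⟨j, hj, e⟩ := List.mem_iff_getElem.1 hg
    simp only [List.length_take, lt_inf_iff] at hj
    exact ⟨⟨j, hj.1⟩, by simpa using e⟩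
  have hnode : ∀ i : Fin L.length, ∃ nd : ArithNode F ι i, ∀ x, L.get i x =
      nd.valueFrom x fun j => L.get ⟨j, j.isLt.trans i.isLt⟩ x := by
    intro i
    rcases hL.nextNode_take i i.isLt with ⟨v, e⟩ | ⟨c, e⟩ | ⟨g, hg, h, hh, e⟩ | ⟨g, hg, h, hh, e⟩
    · exact ⟨.input v, fun x => congrFun e x⟩
    · exact ⟨.const c, fun x => congrFun e x⟩
    · obtain ⟨j, rfl⟩ := mem_take i g hg
      obtain ⟨k, rfl⟩ := mem_take i h hh
      exact ⟨.add j k, fun x => congrFun e x⟩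
    · obtain ⟨j, rfl⟩ := mem_take i g hg
      obtain ⟨k, rfl⟩ := mem_take i h hh
      exact ⟨.mul j k, fun x => congrFun e x⟩
  choose nd hnd using hnode
  obtain ⟨o, ho, rfl⟩ := List.mem_iff_getElem.1 hf
  let C : ArithCircuit F ι := ⟨L.length, nd, ⟨o, ho⟩⟩
  have hC : ∀ (n : ℕ) (hn : n < L.length) (x : ι → F), C.value x ⟨n, hn⟩ = L.get ⟨n, hn⟩ x := by
    intro n
    induction n using Nat.strong_induction_on with
    | _ n ih =>
      intro hn x
      rw [ArithCircuit.value_eq, hnd]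
      exact congrArg _ (funext fun j => ih j j.isLt _ x)
  exact ⟨C, rfl, funext fun x => hC o ho x⟩

/-- All functions in `S` are computed by nodes of one arithmetic circuit of size at most `n`. -/
def CircuitComputable [CommSemiring F] (n : ℕ) (S : Set ((ι → F) → F)) : Prop :=
  ∃ L : List ((ι → F) → F), IsStraightLine L ∧ L.length ≤ n ∧ ∀ f ∈ S, f ∈ L

namespace CircuitComputable

theorem forall_mem_snoc {S : Set ((ι → F) → F)} {f : (ι → F) → F}
    {L : List ((ι → F) → F)} (hS : ∀ g ∈ S, g ∈ L) :
    ∀ g ∈ insert f S, g ∈ L ++ [f] := by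
  rintro g (rfl | hg)
  · simp
  · exact List.mem_append_left _ (hS g hg)

section CommSemiring

variable [CommSemiring F] {m n : ℕ} {S T : Set ((ι → F) → F)} {f g : (ι → F) → F}

theorem mono (h : CircuitComputable n S) (hn : n ≤ m) (hT : T ⊆ S) : CircuitComputable m T := by
  obtain ⟨L, hL, hl, hS⟩ := h
  exact ⟨L, hL, hl.trans hn, fun f hf => hS f (hT hf)⟩

theorem exists_circuit (h : CircuitComputable n {f}) :
    ∃ C : ArithCircuit F ι, C.size ≤ n ∧ C.eval = f := by
  obtain ⟨L, hL, hl, hS⟩ := h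
  obtain ⟨C, hC, e⟩ := hL.exists_circuit (hS f rfl)
  exact ⟨C, hC.trans_le hl, e⟩

theorem empty : CircuitComputable 0 (∅ : Set ((ι → F) → F)) := ⟨[], .nil, le_rfl, by simp⟩

theorem union (h : CircuitComputable n S) (h' : CircuitComputable m T) :
    CircuitComputable (n + m) (S ∪ T) := by
  obtain ⟨L, hL, hl, hS⟩ := h
  obtain ⟨M, hM, hm, hT⟩ := h'
  refine ⟨L ++ M, hL.append hM, by simp; omega, ?_⟩
  rintro f (hf | hf)
  · exact List.mem_append_left _ (hS f hf)
  · exact List.mem_append_right _ (hT f hf)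

theorem range {s : ℕ} {f : Fin s → (ι → F) → F} (h : ∀ i, CircuitComputable n {f i}) :
    CircuitComputable (s * n) (Set.range f) := by
  induction s with
  | zero => exact empty.mono (by simp) (by simp [Set.range_eq_empty])
  | succ s ih =>
    refine ((ih fun i => h i.succ).union (h 0)).mono (by ring_nf; rfl) ?_
    rintro _ ⟨i, rfl⟩
    refine Fin.cases (.inr rfl) (fun i => .inl ⟨i, rfl⟩) i

theorem insert_input (h : CircuitComputable n S) (v : ι) :
    CircuitComputable (n + 1) (insert (fun x => x v) S) := by
  obtain ⟨L, hL, hl, hS⟩ := h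
  refine ⟨_, hL.snoc (.inl ⟨v, rfl⟩), by simpa using hl, ?_⟩
  exact forall_mem_snoc hS

theorem insert_const (h : CircuitComputable n S) (c : F) :
    CircuitComputable (n + 1) (insert (fun _ => c) S) := by
  obtain ⟨L, hL, hl, hS⟩ := h
  refine ⟨_, hL.snoc (.inr (.inl ⟨c, rfl⟩)), by simpa using hl, ?_⟩
  exact forall_mem_snoc hS

theorem insert_add (h : CircuitComputable n S) (hf : f ∈ S) (hg : g ∈ S) :
    CircuitComputable (n + 1) (insert (f + g) S) := by
  obtain ⟨L, hL, hl, hS⟩ := h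
  refine ⟨_, hL.snoc (.inr (.inr (.inl ⟨f, hS f hf, g, hS g hg, rfl⟩))), by simpa using hl, ?_⟩
  exact forall_mem_snoc hS

theorem insert_mul (h : CircuitComputable n S) (hf : f ∈ S) (hg : g ∈ S) :
    CircuitComputable (n + 1) (insert (f * g) S) := by
  obtain ⟨L, hL, hl, hS⟩ := h
  refine ⟨_, hL.snoc (.inr (.inr (.inr ⟨f, hS f hf, g, hS g hg, rfl⟩))), by simpa using hl, ?_⟩
  exact forall_mem_snoc hS

theorem insert_const_mul (h : CircuitComputable n S) (hf : f ∈ S) (c : F) :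
    CircuitComputable (n + 2) (insert (fun x => c * f x) S) :=
  ((h.insert_const c).insert_mul (.inl rfl) (.inr hf)).mono le_rfl
    (Set.insert_subset_insert (Set.subset_insert _ _))

theorem insert_const_add (h : CircuitComputable n S) (hf : f ∈ S) (c : F) :
    CircuitComputable (n + 2) (insert (fun x => c + f x) S) :=
  ((h.insert_const c).insert_add (.inl rfl) (.inr hf)).mono le_rfl
    (Set.insert_subset_insert (Set.subset_insert _ _))

/-- The power is computed by repeated multiplication, which is cheap enough for exponents up to the
cardinality of the prime field. -/
theorem insert_pow (h : CircuitComputable n S) (hf : f ∈ S) (j : ℕ) :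
    CircuitComputable (n + j + 1) (insert (f ^ j) S) := by
  induction j with
  | zero => exact (pow_zero f).symm ▸ h.insert_const 1
  | succ j ih =>
    rw [pow_succ]
    exact (ih.insert_mul (.inl rfl) (.inr hf)).mono le_rfl
      (Set.insert_subset_insert (Set.subset_insert _ _))

theorem insert_sum {s : ℕ} {f : ℕ → (ι → F) → F} (h : CircuitComputable n S)
    (hf : ∀ i < s, f i ∈ S) :
    CircuitComputable (n + s + 1) (insert (∑ i ∈ Finset.range s, f i) S) := by
  induction s with
  | zero => exact h.insert_const 0
  | succ s ih =>
    rw [Finset.sum_range_succ]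
    exact ((ih fun i hi => hf i (by omega)).insert_add (.inl rfl)
      (.inr (hf s (by omega)))).mono le_rfl (Set.insert_subset_insert (Set.subset_insert _ _))

/-- The powers `f, f ^ q, f ^ q ^ 2, …` are computed one from the other. -/
theorem iterate_pow (h : CircuitComputable n {f}) (q s : ℕ) :
    CircuitComputable (n + s * (q + 1)) {g | ∃ i ≤ s, g = f ^ q ^ i} := by
  induction s with
  | zero =>
    refine h.mono (by simp) ?_
    rintro _ ⟨i, hi, rfl⟩
    obtain rfl : i = 0 := by omega
    simp
  | succ s ih =>
    refine (ih.insert_pow ⟨s, le_rfl, rfl⟩ q).mono (by ring_nf; rfl) ?_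
    rintro _ ⟨i, hi, rfl⟩
    rcases hi.eq_or_lt with rfl | hi
    · exact .inl (by rw [← pow_mul, pow_succ])
    · exact .inr ⟨i, by omega, rfl⟩

end CommSemiring

end CircuitComputable

/-- The value of a node, given the values of the earlier nodes. -/
def BoolNode.valueFrom {n i : ℕ} (nd : BoolNode n i) (x : Fin n → Bool) (val : Fin i → Bool) :
    Bool :=
  match nd with
  | .input v => x v
  | .const b => b
  | .not j => !val j
  | .and j k => val j && val k
  | .or j k => val j || val k

theorem BoolCircuit.value_eq {n : ℕ} (C : BoolCircuit n) (x : Fin n → Bool) (i : Fin C.size) :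
    C.value x i = (C.node i).valueFrom x fun j => C.value x ⟨j, j.isLt.trans i.isLt⟩ := by
  rw [BoolCircuit.value]
  cases C.node i <;> rfl

/-- The indicator function of a predicate, with values in `F`. -/
def indicatorFun (F : Type) [Zero F] [One F] {α : Type} (b : α → Bool) (x : α) : F :=
  bif b x then 1 else 0

/-- Simulation of a boolean circuit whose inputs are predicates with computable indicator
functions. -/
theorem CircuitComputable.boolCircuit [CommRing F] {N n : ℕ} (C : BoolCircuit N)
    (W : Fin N → (ι → F) → Bool) (hW : ∀ i, CircuitComputable n {indicatorFun F (W i)}) :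
    CircuitComputable (N * n + 4 * C.size + 1)
      {indicatorFun F fun x => C.eval fun i => W i x} := by
  -- the constant `-1`, the inputs, and the nodes numbered below `j`
  let S : ℕ → Set ((ι → F) → F) := fun j => insert (fun _ => -1)
    (Set.range (fun i => indicatorFun F (W i)) ∪
      {g | ∃ i : Fin C.size, i.val < j ∧ g = indicatorFun F fun x => C.value (fun i => W i x) i})
  have key : ∀ j ≤ C.size, CircuitComputable (N * n + 4 * j + 1) (S j) := by
    intro j hj
    induction j with
    | zero =>
      refine ((CircuitComputable.range hW).insert_const (-1)).mono le_rfl ?_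
      simp [S]
    | succ j ih =>
      have h := ih (by omega)
      let i : Fin C.size := ⟨j, hj⟩
      suffices CircuitComputable (N * n + 4 * j + 1 + 4)
          (insert (indicatorFun F fun x => C.value (fun i => W i x) i) (S j)) by
        refine this.mono (by ring_nf; rfl) ?_
        rintro g (rfl | hg | ⟨i', hi', rfl⟩)
        · exact .inr (.inl rfl)
        · exact .inr (.inr (.inl hg))
        · rcases Nat.lt_succ_iff_lt_or_eq.1 hi' with h | h
          · exact .inr (.inr (.inr ⟨i', h, rfl⟩))
          · obtain rfl : i' = i := Fin.ext h
            exact .inl rfl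
      have hlt : ∀ a : Fin i.val, (indicatorFun F fun x =>
          C.value (fun i => W i x) ⟨a, a.isLt.trans i.isLt⟩) ∈ S j :=
        fun a => .inr (.inr ⟨⟨a, a.isLt.trans i.isLt⟩, a.isLt, rfl⟩)
      have hneg : (fun _ => -1) ∈ S j := .inl rfl
      cases hnd : C.node i with
      | input v =>
        have e : (indicatorFun F fun x => C.value (fun i => W i x) i) = indicatorFun F (W v) := by
          funext x
          simp only [indicatorFun]
          rw [BoolCircuit.value_eq, hnd]
          simp only [BoolNode.valueFrom]
        rw [e]
        refine h.mono (by omega) (Set.insert_subset ?_ le_rfl)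
        exact .inr (.inl ⟨v, rfl⟩)
      | const b =>
        have e : (indicatorFun F fun x => C.value (fun i => W i x) i) =
            fun _ => bif b then 1 else 0 := by
          funext x
          simp only [indicatorFun]
          rw [BoolCircuit.value_eq, hnd]
          simp only [BoolNode.valueFrom]
        rw [e]
        exact (h.insert_const _).mono (by omega) le_rfl
      | not a =>
        have e : (indicatorFun F fun x => C.value (fun i => W i x) i) = fun x => 1 + (-1 *
            indicatorFun F (fun x => C.value (fun i => W i x) ⟨a, a.isLt.trans i.isLt⟩) x) := by
          funext x
          simp only [indicatorFun]
          rw [BoolCircuit.value_eq, hnd]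
          simp only [BoolNode.valueFrom]
          cases C.value (fun i => W i x) ⟨a, a.isLt.trans i.isLt⟩ <;> simp
        rw [e]
        exact ((h.insert_const_mul (hlt a) (-1)).insert_const_add (.inl rfl) 1).mono (by omega)
          (Set.insert_subset_insert (Set.subset_insert _ _))
      | and a b =>
        have e : (indicatorFun F fun x => C.value (fun i => W i x) i) =
            (indicatorFun F fun x => C.value (fun i => W i x) ⟨a, a.isLt.trans i.isLt⟩) *
            (indicatorFun F fun x => C.value (fun i => W i x) ⟨b, b.isLt.trans i.isLt⟩) := by
          funext x
          simp only [Pi.mul_apply]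
          simp only [indicatorFun]
          rw [BoolCircuit.value_eq, hnd]
          simp only [BoolNode.valueFrom]
          cases C.value (fun i => W i x) ⟨a, a.isLt.trans i.isLt⟩ <;>
          cases C.value (fun i => W i x) ⟨b, b.isLt.trans i.isLt⟩ <;> simp
        rw [e]
        exact (h.insert_mul (hlt a) (hlt b)).mono (by omega) le_rfl
      | or a b =>
        have e : (indicatorFun F fun x => C.value (fun i => W i x) i) =
            (indicatorFun F fun x => C.value (fun i => W i x) ⟨a, a.isLt.trans i.isLt⟩) +
            ((indicatorFun F fun x => C.value (fun i => W i x) ⟨b, b.isLt.trans i.isLt⟩) +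
            (fun _ => -1) *
            ((indicatorFun F fun x => C.value (fun i => W i x) ⟨a, a.isLt.trans i.isLt⟩) *
            (indicatorFun F fun x => C.value (fun i => W i x) ⟨b, b.isLt.trans i.isLt⟩))) := by
          funext x
          simp only [Pi.mul_apply, Pi.add_apply]
          simp only [indicatorFun]
          rw [BoolCircuit.value_eq, hnd]
          simp only [BoolNode.valueFrom]
          cases C.value (fun i => W i x) ⟨a, a.isLt.trans i.isLt⟩ <;>
          cases C.value (fun i => W i x) ⟨b, b.isLt.trans i.isLt⟩ <;> simp
        rw [e]
        exact ((((h.insert_mul (hlt a) (hlt b)).insert_mul (.inr hneg) (.inl rfl)).insert_add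
          (.inr (.inr (hlt b))) (.inl rfl)).insert_add (.inr (.inr (.inr (hlt a))))
          (.inl rfl)).mono le_rfl (Set.insert_subset_insert fun f hf => .inr (.inr (.inr hf)))
  refine (key _ le_rfl).mono le_rfl ?_
  rintro _ rfl
  exact .inr (.inr ⟨C.output, C.output.isLt, rfl⟩)

end StraightLine

/-! ### Linear systems with conflicting columns as formulas -/

namespace LinearSystem

variable {K A : Type} {N : ℕ}

/-- The system with coefficients `Y` (rows `A`, columns `Fin N`) has a nonzero solution in which no
two columns in the relation `conf` have nonzero entries. -/
def Solvable [Field K] (conf : Fin N → Fin N → Prop) (Y : A → Fin N → K) : Prop :=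
  ∃ z : Fin N → K, z ≠ 0 ∧ (∀ a, ∑ c, z c * Y a c = 0) ∧
    ∀ c c', conf c c' → z c = 0 ∨ z c' = 0

/-- The propositional variables: `inl (c, t)` says that the entry `z c` is `t`, and `inr (a, i, s)`
says that the first `i` terms of the sum in the row `a` add up to `s`. -/
abbrev Var (K A : Type) (N : ℕ) : Type := (Fin N × K) ⊕ (A × Fin (N + 1) × K)

theorem card_var [Finite K] [Finite A] :
    Nat.card (Var K A N) = N * Nat.card K + Nat.card A * ((N + 1) * Nat.card K) := by
  simp only [Nat.card_sum, Nat.card_prod, Nat.card_fin]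

/-- Two values of entries that exclude each other. -/
def Conflict [Zero K] (conf : Fin N → Fin N → Prop) (p : (Fin N × K) × (Fin N × K)) : Prop :=
  p.1.1 = p.2.1 ∧ p.1.2 ≠ p.2.2 ∨ conf p.1.1 p.2.1 ∧ p.1.2 ≠ 0 ∧ p.2.2 ≠ 0

/-- The clauses, in this order: some entry is nonzero; every entry has a value; values of entries
that exclude each other; partial sums start with `0`; total sums are not nonzero; and the passage
from one partial sum to the next. -/
abbrev Clause (K A : Type) [Zero K] (N : ℕ) (conf : Fin N → Fin N → Prop) : Type :=
  Unit ⊕ Fin N ⊕ {p : (Fin N × K) × (Fin N × K) // Conflict conf p} ⊕ A ⊕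
    (A × {s : K // s ≠ 0}) ⊕ (A × Fin N × K × K)

open scoped Classical in
/-- The positive literals of the clauses. -/
noncomputable def posLit [Field K] (conf : Fin N → Fin N → Prop) (Y : A → Fin N → K) :
    Clause K A N conf → Var K A N → Bool
  | .inl _, .inl v => decide (v.2 ≠ 0)
  | .inr (.inl c), .inl v => decide (v.1 = c)
  | .inr (.inr (.inr (.inl a))), .inr v => decide (v = (a, 0, 0))
  | .inr (.inr (.inr (.inr (.inr r)))), .inr v =>
    decide (v.1 = r.1 ∧ v.2.1 = r.2.1.succ) && decide (v.2.2 = r.2.2.1 + r.2.2.2 * Y r.1 r.2.1)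
  | _, _ => false

open scoped Classical in
/-- The negated literals of the clauses. -/
noncomputable def negLit [Field K] (conf : Fin N → Fin N → Prop) :
    Clause K A N conf → Var K A N → Bool
  | .inr (.inr (.inl p)), .inl v => decide (v = p.1.1 ∨ v = p.1.2)
  | .inr (.inr (.inr (.inr (.inl r)))), .inr v => decide (v = (r.1, Fin.last N, r.2.1))
  | .inr (.inr (.inr (.inr (.inr r)))), .inl v => decide (v = (r.2.1, r.2.2.2))
  | .inr (.inr (.inr (.inr (.inr r)))), .inr v => decide (v = (r.1, r.2.1.castSucc, r.2.2.1))
  | _, _ => false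

theorem partialSum_last {M : Type} [AddCommMonoid M] (f : Fin N → M) :
    Fin.partialSum f (Fin.last N) = ∑ c, f c := by
  rw [Fin.partialSum, List.take_of_length_le (by simp), List.sum_ofFn]

variable [Field K] (conf : Fin N → Fin N → Prop)

theorem posLit_and_negLit (Y : A → Fin N → K) (r : Clause K A N conf) (v : Var K A N) :
    (posLit conf Y r v && negLit conf r v) = false := by
  rcases r with r | r | r | r | r | r <;> rcases v with v | v <;>
    simp [posLit, negLit]
  rintro h1 h2 h3 rfl
  exact absurd h2 (by simpa using (Fin.castSucc_lt_succ (i := r.2.1)).ne)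

open scoped Classical in
/-- The literals depend on the coefficients only through tests of their multiples. -/
theorem posLit_eq_const_or (r : Clause K A N conf) (v : Var K A N) :
    (∃ b, ∀ Y : A → Fin N → K, posLit conf Y r v = b) ∨
      ∃ a c t d, ∀ Y : A → Fin N → K, posLit conf Y r v = decide (t * Y a c = d) := by
  rcases r with r | r | r | r | r | r <;> rcases v with v | v
  case inr.inr.inr.inr.inr.inr =>
    by_cases h : v.1 = r.1 ∧ v.2.1 = r.2.1.succ
    · refine .inr ⟨r.1, r.2.1, r.2.2.2, v.2.2 - r.2.2.1, fun Y => ?_⟩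
      simp only [posLit, h, and_self, decide_true, Bool.true_and, decide_eq_decide]
      rw [eq_sub_iff_add_eq', eq_comm]
    · exact .inl ⟨false, fun Y => by simp only [posLit, h, decide_false, Bool.false_and]⟩
  all_goals exact .inl ⟨_, fun _ => rfl⟩

/-- Only the unique values of entries and the truth of the actual partial sums matter; an assignment
may make further partial sum variables true. -/
theorem solvable_of_satisfies {Y : A → Fin N → K} {v : Var K A N → Bool}
    (hv : Satisfies (posLit conf Y) (negLit conf) v) : Solvable conf Y := by
  have hz : ∀ c, ∃ t, v (.inl (c, t)) = true := by
    intro c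
    obtain ⟨⟨c', t⟩ | x, h⟩ := hv (.inr (.inl c))
    · simp only [posLit, negLit, decide_eq_true_eq, Bool.false_eq_true, false_and, or_false] at h
      exact ⟨t, h.1 ▸ h.2⟩
    · simp [posLit, negLit] at h
  choose z hz using hz
  have hconf : ∀ p, Conflict conf p → v (.inl p.1) = true → v (.inl p.2) = true → False := by
    intro p hp h1 h2
    obtain ⟨x | x, h⟩ := hv (.inr (.inr (.inl ⟨p, hp⟩)))
    · simp only [posLit, negLit, decide_eq_true_eq, Bool.false_eq_true, false_and, false_or] at h
      obtain ⟨rfl | rfl, h⟩ := h <;> simp_all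
    · simp [posLit, negLit] at h
  have huniq : ∀ c t, v (.inl (c, t)) = true → t = z c := fun c t h => by
    by_contra hne
    exact hconf ((c, t), (c, z c)) (.inl ⟨rfl, hne⟩) h (hz c)
  have hsum : ∀ a i, v (.inr (a, i, Fin.partialSum (fun c => z c * Y a c) i)) = true := by
    intro a i
    induction i using Fin.induction with
    | zero =>
      obtain ⟨x | x, h⟩ := hv (.inr (.inr (.inr (.inl a))))
      · simp [posLit, negLit] at h
      · simp only [posLit, negLit, decide_eq_true_eq, Bool.false_eq_true, false_and, or_false] at h
        simpa [h.1] using h.2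
    | succ i ih =>
      obtain ⟨x | x, h⟩ := hv (.inr (.inr (.inr (.inr (.inr
        (a, i, Fin.partialSum (fun c => z c * Y a c) i.castSucc, z i))))))
      · simp only [posLit, negLit, decide_eq_true_eq, Bool.false_eq_true, false_and, false_or] at h
        simp [h.1, hz] at h
      · simp only [posLit, negLit, decide_eq_true_eq, Bool.and_eq_true] at h
        rcases h with ⟨⟨⟨h1, h2⟩, h3⟩, h⟩ | ⟨rfl, h⟩
        · rw [Fin.partialSum_succ, ← h3, ← h1, ← h2]
          exact h
        · simp [ih] at h
  refine ⟨z, ?_, fun a => ?_, fun c c' hc => ?_⟩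
  · rintro rfl
    obtain ⟨⟨c, t⟩ | x, h⟩ := hv (.inl ())
    · simp only [posLit, negLit, decide_eq_true_eq, Bool.false_eq_true, false_and, or_false] at h
      exact h.1 (huniq c t h.2)
    · simp [posLit, negLit] at h
  · by_contra hne
    obtain ⟨x | x, h⟩ := hv (.inr (.inr (.inr (.inr (.inl (a, ⟨_, hne⟩))))))
    · simp [posLit, negLit] at h
    · simp only [posLit, negLit, decide_eq_true_eq, Bool.false_eq_true, false_and, false_or] at h
      have := hsum a (Fin.last N)
      rw [partialSum_last, ← h.1, h.2] at this
      simp at this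
  · by_contra! hne
    exact hconf ((c, z c), (c', z c')) (.inr ⟨hc, hne⟩) (hz c) (hz c')

theorem exists_satisfies_of_solvable {Y : A → Fin N → K} (h : Solvable conf Y) :
    ∃ v, Satisfies (posLit conf Y) (negLit conf) v := by
  classical
  obtain ⟨z, hz, hsum, hconf⟩ := h
  have hlast : ∀ a, Fin.partialSum (fun c => z c * Y a c) (Fin.last N) = 0 := by
    intro a
    rw [← hsum a, partialSum_last]
  refine ⟨fun
    | .inl x => decide (x.2 = z x.1)
    | .inr x => decide (x.2.2 = Fin.partialSum (fun c => z c * Y x.1 c) x.2.1), ?_⟩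
  rintro (r | c | ⟨p, hp⟩ | a | ⟨a, s, hs⟩ | ⟨a, c, s, t⟩)
  · obtain ⟨c, hc⟩ := Function.ne_iff.1 hz
    exact ⟨.inl (c, z c), .inl (by simpa [posLit] using hc)⟩
  · exact ⟨.inl (c, z c), .inl (by simp [posLit])⟩
  · by_cases h1 : p.1.2 = z p.1.1
    · refine ⟨.inl p.2, .inr ⟨by simp [negLit], ?_⟩⟩
      simp only [decide_eq_false_iff_not]
      intro h2
      rcases hp with ⟨h, hne⟩ | ⟨h, hne⟩
      · exact hne (by rw [h1, h2, h])
      · rw [h1, h2] at hne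
        exact (hconf _ _ h).elim hne.1 hne.2
    · exact ⟨.inl p.1, .inr ⟨by simp [negLit], by simpa using h1⟩⟩
  · exact ⟨.inr (a, 0, 0), .inl (by simp [posLit])⟩
  · exact ⟨.inr (a, Fin.last N, s), .inr ⟨by simp [negLit], by simpa [hlast] using hs⟩⟩
  · by_cases h1 : t = z c
    · by_cases h2 : s = Fin.partialSum (fun c => z c * Y a c) c.castSucc
      · refine ⟨.inr (a, c.succ, s + t * Y a c), .inl ⟨by simp [posLit], ?_⟩⟩
        simp [Fin.partialSum_succ, h1, h2]
      · exact ⟨.inr (a, c.castSucc, s), .inr ⟨by simp [negLit], by simpa using h2⟩⟩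
    · exact ⟨.inl (c, t), .inr ⟨by simp [negLit], by simpa using h1⟩⟩

theorem exists_satisfies_iff (Y : A → Fin N → K) :
    (∃ v, Satisfies (posLit conf Y) (negLit conf) v) ↔ Solvable conf Y :=
  ⟨fun ⟨_, hv⟩ => solvable_of_satisfies conf hv, exists_satisfies_of_solvable conf⟩

theorem card_clause_le [Finite K] [Finite A] : Nat.card (Clause K A N conf) ≤
    1 + (N + ((N * Nat.card K) * (N * Nat.card K) + (Nat.card A + (Nat.card A * Nat.card K +
      Nat.card A * (N * (Nat.card K * Nat.card K)))))) := by
  have h1 : Nat.card {p : (Fin N × K) × (Fin N × K) // Conflict conf p} ≤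
      (N * Nat.card K) * (N * Nat.card K) := by
    refine (Finite.card_subtype_le _).trans ?_
    simp [Nat.card_prod]
  have h2 : Nat.card {s : K // s ≠ 0} ≤ Nat.card K := Finite.card_subtype_le _
  simp only [Nat.card_sum, Nat.card_prod, Nat.card_unique, Nat.card_fin]
  gcongr

end LinearSystem

/-! ### Tests of traces by arithmetic circuits -/

section Trace

variable {K F ι : Type} [Field K] [Field F] [Finite F] [Algebra K F]

/-- The trace is a sum of iterated Frobenius powers. -/
theorem CircuitComputable.trace (c : F) (v : ι) :
    CircuitComputable (3 + Module.finrank K F * (Nat.card K + 1) + Module.finrank K F + 1)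
      {fun x : ι → F => algebraMap K F (Algebra.trace K F (c * x v))} := by
  have h := ((empty.insert_input (F := F) v).insert_const_mul (.inl rfl) c).mono le_rfl
    (T := {fun x => c * x v}) (by simp)
  refine ((h.iterate_pow (Nat.card K) (Module.finrank K F)).insert_sum
    (s := Module.finrank K F) (f := fun i => (fun x => c * x v) ^ Nat.card K ^ i)
    fun i hi => ⟨i, hi.le, rfl⟩).mono (by omega) ?_
  rintro _ rfl
  refine .inl (funext fun x => ?_)
  rw [FiniteField.algebraMap_trace_eq_sum_pow]
  simp

open scoped Classical in
/-- Equality in `K` is tested by the power with exponent `Nat.card K - 1`. -/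
theorem CircuitComputable.trace_eq [Finite K] (c : F) (v : ι) (t : K) :
    CircuitComputable (Module.finrank K F * (Nat.card K + 1) + Module.finrank K F + Nat.card K + 10)
      {indicatorFun F fun x : ι → F => decide (Algebra.trace K F (c * x v) = t)} := by
  have hcard : 1 < Nat.card K := Finite.one_lt_card
  refine (((((trace (K := K) c v).insert_const_add (Set.mem_singleton _)
    (-algebraMap K F t)).insert_pow (.inl rfl) (Nat.card K - 1)).insert_const_mul
    (.inl rfl) (-1)).insert_const_add (.inl rfl) 1).mono (by omega) ?_
  rintro _ rfl
  refine .inl (funext fun x => ?_)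
  simp only [indicatorFun, Pi.pow_apply]
  rw [← map_neg, ← map_add, ← map_pow]
  by_cases h : Algebra.trace K F (c * x v) = t
  · simp [h, Nat.sub_ne_zero_of_lt hcard]
  · have h' : -t + Algebra.trace K F (c * x v) ≠ 0 := by
      rw [neg_add_eq_sub]
      exact sub_ne_zero.2 h
    have : Fintype K := Fintype.ofFinite K
    rw [Nat.card_eq_fintype_card, FiniteField.pow_card_sub_one_eq_one _ h']
    simp [h]

end Trace

/-! ### Zeros of `E` as solutions of linear systems -/

section Zeros

open LinearSystem

variable {K F : Type} [Field K] [Field F] [Algebra K F] {k m d N : ℕ}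

theorem eval_EPoly_eq_zero_iff (X : EVar k m → F) :
    MvPolynomial.eval X (EPoly F k m) = 0 ↔ ∃ σ : Fin m → Fin k, ∃ v ≠ 0,
      (Matrix.of fun a i : Fin m => X (a, (σ i, i))).mulVec v = 0 := by
  simp only [EPoly, map_prod, Finset.prod_eq_zero_iff, Finset.mem_univ, true_and]
  refine exists_congr fun σ => ?_
  rw [Matrix.exists_mulVec_eq_zero_iff, detSigma, RingHom.map_det]
  have : (MvPolynomial.eval X).mapMatrix
      (Matrix.of fun a i : Fin m => MvPolynomial.X (R := F) ((a, (σ i, i)) : EVar k m)) =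
      Matrix.of fun a i : Fin m => X (a, (σ i, i)) := by
    ext a i
    simp
  rw [this]

/-- The coefficients of the linear system over `K` for a vector in the kernel of a matrix with
columns `X^j_i` over `F`: the unknowns are the coordinates of the entries of the vector in the basis
`b`, and the equations say that all products of the elements of `b` with the entries of the image
have trace zero. The equivalence `e` numbers the triples of `j`, `i` and a coordinate. -/
noncomputable def traceCoeff (b : Module.Basis (Fin d) K F) (e : Fin N ≃ Fin k × Fin m × Fin d)
    (X : EVar k m → F) (a : Fin m × Fin d) (c : Fin N) : K :=
  Algebra.trace K F (b a.2 * b (e c).2.2 * X (a.1, ((e c).1, (e c).2.1)))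

/-- The columns of the linear system that belong to the same `i` and to different `j`. -/
def sameIndex (e : Fin N ≃ Fin k × Fin m × Fin d) (c c' : Fin N) : Prop :=
  (e c).2.1 = (e c').2.1 ∧ (e c).1 ≠ (e c').1

/-- A solution supported on the columns chosen by `σ`, seen as a vector over `F`. -/
theorem sum_mul_traceCoeff (b : Module.Basis (Fin d) K F) (e : Fin N ≃ Fin k × Fin m × Fin d)
    (X : EVar k m → F) (σ : Fin m → Fin k) (w : Fin m → Fin d → K) (z : Fin N → K)
    (hz : ∀ c, z c = if (e c).1 = σ (e c).2.1 then w (e c).2.1 (e c).2.2 else 0)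
    (a : Fin m × Fin d) :
    ∑ c, z c * traceCoeff b e X a c = Algebra.trace K F
      (b a.2 * (Matrix.of fun a i : Fin m => X (a, (σ i, i))).mulVec
        (fun i => ∑ s, w i s • b s) a.1) := by
  have h1 : ∑ c, z c * traceCoeff b e X a c = ∑ p : Fin k × Fin m × Fin d,
      (if p.1 = σ p.2.1 then w p.2.1 p.2.2 else 0) *
        Algebra.trace K F (b a.2 * b p.2.2 * X (a.1, (p.1, p.2.1))) := by
    rw [← Equiv.sum_comp e]
    simp only [hz, traceCoeff]
  rw [h1, Fintype.sum_prod_type, Finset.sum_comm, Fintype.sum_prod_type]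
  simp only [Matrix.mulVec, dotProduct, Matrix.of_apply, Finset.mul_sum, map_sum]
  refine Finset.sum_congr rfl fun i _ => Finset.sum_congr rfl fun s _ => ?_
  simp only [ite_mul, zero_mul, Finset.sum_ite_eq', Finset.mem_univ, if_true]
  rw [mul_smul_comm, mul_smul_comm, map_smul, smul_eq_mul]
  ring_nf

theorem solvable_traceCoeff_iff [Finite F] (b : Module.Basis (Fin d) K F)
    (e : Fin N ≃ Fin k × Fin m × Fin d) (hk : 0 < k) (X : EVar k m → F) :
    Solvable (sameIndex e) (traceCoeff b e X) ↔ MvPolynomial.eval X (EPoly F k m) = 0 := by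
  classical
  have : FiniteDimensional K F := Module.Finite.of_basis b
  have : Finite K := Finite.of_injective _ (algebraMap K F).injective
  have hnondeg : ∀ y : F, (∀ u, Algebra.trace K F (b u * y) = 0) → y = 0 := by
    intro y hy
    refine (traceForm_nondegenerate K F).1 y fun x => ?_
    rw [Algebra.traceForm_apply, mul_comm, ← b.sum_repr x, Finset.sum_mul, map_sum]
    refine Finset.sum_eq_zero fun u _ => ?_
    rw [smul_mul_assoc, map_smul, hy, smul_zero]
  rw [eval_EPoly_eq_zero_iff]
  constructor
  · rintro ⟨z, hz0, hsum, hconf⟩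
    -- choose `σ i` as the only `j` with a nonzero entry, if there is one
    have hσ : ∀ i, ∃ j, ∀ c, (e c).2.1 = i → z c ≠ 0 → (e c).1 = j := by
      intro i
      by_cases h : ∃ c, (e c).2.1 = i ∧ z c ≠ 0
      · obtain ⟨c, hc, hzc⟩ := h
        refine ⟨(e c).1, fun c' hc' hzc' => ?_⟩
        by_contra hne
        exact (hconf c' c ⟨hc'.trans hc.symm, hne⟩).elim hzc' hzc
      · exact ⟨⟨0, hk⟩, fun c hc hzc => (h ⟨c, hc, hzc⟩).elim⟩
    choose σ hσ using hσ
    let w : Fin m → Fin d → K := fun i s => z (e.symm (σ i, i, s))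
    have hw : ∀ c, z c = if (e c).1 = σ (e c).2.1 then w (e c).2.1 (e c).2.2 else 0 := by
      intro c
      split_ifs with h
      · simp only [w]
        rw [← h]
        exact congrArg z (e.symm_apply_apply c).symm
      · by_contra hne
        exact h (hσ _ c rfl hne)
    refine ⟨σ, fun i => ∑ s, w i s • b s, ?_, ?_⟩
    · intro h0
      refine hz0 (funext fun c => ?_)
      rw [hw c]
      have := Fintype.linearIndependent_iff.1 b.linearIndependent _ (congrFun h0 (e c).2.1)
      simp [this]
    · funext a
      refine hnondeg _ fun u => ?_
      rw [← sum_mul_traceCoeff b e X σ w z hw (a, u)]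
      exact hsum _
  · rintro ⟨σ, v, hv0, hv⟩
    let w : Fin m → Fin d → K := fun i s => b.repr (v i) s
    let z : Fin N → K := fun c => if (e c).1 = σ (e c).2.1 then w (e c).2.1 (e c).2.2 else 0
    have hwv : (fun i => ∑ s, w i s • b s) = v := funext fun i => b.sum_repr (v i)
    refine ⟨z, ?_, fun a => ?_, ?_⟩
    · intro h0
      refine hv0 ?_
      rw [← hwv]
      funext i
      refine Finset.sum_eq_zero fun s _ => ?_
      have := congrFun h0 (e.symm (σ i, i, s))
      simp only [z, Equiv.apply_symm_apply, if_true, Pi.zero_apply] at this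
      rw [this, zero_smul]
    · rw [sum_mul_traceCoeff b e X σ w z (fun _ => rfl), hwv, hv]
      simp
    · rintro c c' ⟨h1, h2⟩
      by_contra! hne
      have h3 : ∀ c, z c ≠ 0 → (e c).1 = σ (e c).2.1 := fun c hc => by
        by_contra h
        exact hc (if_neg h)
      exact h2 (by rw [h3 c hne.1, h3 c' hne.2, h1])

end Zeros

/-! ### Polynomial bounds -/

section PolyBounded

variable {f g : ℕ → ℕ}

theorem polyBounded_iff : PolyBounded f ↔ ∃ C e : ℕ, ∀ n, f n ≤ C * (n + 1) ^ e := by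
  constructor
  · rintro ⟨c, hc⟩
    refine ⟨c + 1, c, fun n => (hc n).trans ?_⟩
    have h1 : n ^ c ≤ (n + 1) ^ c := Nat.pow_le_pow_left (by omega) c
    have h2 : 1 ≤ (n + 1) ^ c := Nat.one_le_pow _ _ (by omega)
    nlinarith
  · rintro ⟨C, e, h⟩
    refine ⟨C * 2 ^ e + C + 2 * e, fun n => (h n).trans ?_⟩
    rcases Nat.lt_or_ge n 2 with hn | hn
    · have : C * (n + 1) ^ e ≤ C * 2 ^ e :=
        Nat.mul_le_mul_left _ (Nat.pow_le_pow_left (by omega) e)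
      omega
    · have h1 : C ≤ n ^ C := (Nat.lt_pow_self hn).le
      have h2 : (n + 1) ^ e ≤ n ^ (2 * e) := by
        rw [pow_mul]
        exact Nat.pow_le_pow_left (by nlinarith) e
      calc C * (n + 1) ^ e ≤ n ^ C * n ^ (2 * e) := Nat.mul_le_mul h1 h2
        _ = n ^ (C + 2 * e) := (pow_add _ _ _).symm
        _ ≤ n ^ (C * 2 ^ e + C + 2 * e) := Nat.pow_le_pow_right (by omega) (by omega)
        _ ≤ _ := Nat.le_add_right _ _

namespace PolyBounded

theorem mono (hg : PolyBounded g) (h : ∀ n, f n ≤ g n) : PolyBounded f := by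
  obtain ⟨c, hc⟩ := hg
  exact ⟨c, fun n => (h n).trans (hc n)⟩

theorem const (c : ℕ) : PolyBounded fun _ => c := ⟨c, fun _ => Nat.le_add_left _ _⟩

theorem pow_self (c : ℕ) : PolyBounded fun n => n ^ c := ⟨c, fun _ => Nat.le_add_right _ _⟩

theorem add (hf : PolyBounded f) (hg : PolyBounded g) : PolyBounded fun n => f n + g n := by
  rw [polyBounded_iff] at *
  obtain ⟨C, e, h⟩ := hf
  obtain ⟨C', e', h'⟩ := hg
  refine ⟨C + C', e + e', fun n => ?_⟩
  have h1 : (n + 1) ^ e ≤ (n + 1) ^ (e + e') := Nat.pow_le_pow_right (by omega) (by omega)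
  have h2 : (n + 1) ^ e' ≤ (n + 1) ^ (e + e') := Nat.pow_le_pow_right (by omega) (by omega)
  calc f n + g n ≤ C * (n + 1) ^ e + C' * (n + 1) ^ e' := add_le_add (h n) (h' n)
    _ ≤ C * (n + 1) ^ (e + e') + C' * (n + 1) ^ (e + e') := by gcongr
    _ = _ := by ring

theorem mul (hf : PolyBounded f) (hg : PolyBounded g) : PolyBounded fun n => f n * g n := by
  rw [polyBounded_iff] at *
  obtain ⟨C, e, h⟩ := hf
  obtain ⟨C', e', h'⟩ := hg
  refine ⟨C * C', e + e', fun n => (Nat.mul_le_mul (h n) (h' n)).trans (le_of_eq ?_)⟩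
  ring

theorem pow (hf : PolyBounded f) (c : ℕ) : PolyBounded fun n => f n ^ c := by
  induction c with
  | zero => simpa using const 1
  | succ c ih => simpa only [pow_succ] using ih.mul hf

end PolyBounded

theorem polyBounded_extDegree (a : ℝ) (ha : 0 < a) : PolyBounded (extDegree a) := by
  refine (PolyBounded.pow_self ⌈a⌉₊).mono fun n => ?_
  rcases Nat.eq_zero_or_pos n with rfl | hn
  · simp [extDegree, Real.zero_rpow ha.ne']
  · rw [extDegree]
    refine Nat.floor_le_of_le ?_
    push_cast
    rw [← Real.rpow_natCast]
    exact Real.rpow_le_rpow_of_exponent_le (by exact_mod_cast hn) (Nat.le_ceil a)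

end PolyBounded

theorem extDegree_pos {a : ℝ} (ha : 0 ≤ a) {n : ℕ} (hn : 0 < n) : 0 < extDegree a n := by
  rw [extDegree, Nat.floor_pos]
  exact Real.one_le_rpow (by exact_mod_cast hn) ha

/-! ### Circuits for a power of `E` -/

open LinearSystem in
/-- If satisfiability has circuits of size at most `n ^ c + c`, then the power of `E` that is the
indicator function of the complement of its zeros has small circuits: `6 * D ^ 4` bounds the number
of clauses, `3 * D ^ 3` the number of variables, and `48 * D ^ 7` the length of the formula. -/
theorem exists_circuit_EPoly_pow {c : ℕ}
    (hc : ∀ n : ℕ, ∃ C : BoolCircuit n, C.size ≤ n ^ c + c ∧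
      ∀ x : Fin n → Bool, C.eval x = true ↔ List.ofFn x ∈ cnfSat)
    (K F : Type) [Field K] [Field F] [Finite F] [Algebra K F] {k m D : ℕ} (hk : 0 < k)
    (hN : k * (m * Module.finrank K F) ≤ D) (hA : m * Module.finrank K F ≤ D)
    (hd : Module.finrank K F ≤ D) (hq : Nat.card K ≤ D) :
    ∃ C : ArithCircuit F (EVar k m), C.size ≤ 1000 * D ^ 9 + 4 * ((48 * D ^ 7) ^ c + c) + 5 ∧
      C.Computes (EPoly F k m ^ (Nat.card F - 1)) := by
  classical
  have : Finite K := Finite.of_injective _ (algebraMap K F).injective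
  have hD : 1 ≤ D := Nat.card_pos.trans_le hq
  let d := Module.finrank K F
  let q := Nat.card K
  let N := k * (m * d)
  let b : Module.Basis (Fin d) K F := Module.finBasis K F
  let e : Fin N ≃ Fin k × Fin m × Fin d :=
    finProdFinEquiv.symm.trans ((Equiv.refl _).prodCongr finProdFinEquiv.symm)
  let κ := Clause K (Fin m × Fin d) N (sameIndex e)
  let V := Var K (Fin m × Fin d) N
  let er : κ ≃ Fin (Nat.card κ) := Finite.equivFin κ
  let ev : V ≃ Fin (Nat.card V) := Finite.equivFin V
  -- the formula, with bits depending on the matrix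
  let P : Fin (Nat.card κ) → Fin (Nat.card V) → (EVar k m → F) → Bool := fun r v X =>
    posLit (sameIndex e) (traceCoeff b e X) (er.symm r) (ev.symm v)
  let Q : Fin (Nat.card κ) → Fin (Nat.card V) → (EVar k m → F) → Bool := fun r v _ =>
    negLit (sameIndex e) (er.symm r) (ev.symm v)
  let W : List ((EVar k m → F) → Bool) := (cnfWord (fun _ => true) P Q).reverse
  have hW : ∀ X, List.ofFn (fun i => W.get i X) ∈ cnfSat ↔
      MvPolynomial.eval X (EPoly F k m) = 0 := by
    intro X
    have h1 : List.ofFn (fun i => W.get i X) =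
        (cnfWord true (fun r v => P r v X) (fun r v => Q r v X)).reverse := by
      rw [← map_cnfWord (fun g => g X) (fun _ => true) P Q, ← List.map_reverse]
      conv_rhs => rw [← List.ofFn_get (cnfWord (fun _ => true) P Q).reverse, List.map_ofFn]
      rfl
    rw [h1, reverse_cnfWord_mem_cnfSat Nat.card_pos _ _
      fun r v => posLit_and_negLit _ _ _ _, ← solvable_traceCoeff_iff b e hk,
      ← exists_satisfies_iff]
    constructor
    · rintro ⟨v, hv⟩
      refine ⟨fun x => v (ev x), fun r => ?_⟩
      obtain ⟨x, hx⟩ := hv (er r)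
      exact ⟨ev.symm x, by simpa [P, Q] using hx⟩
    · rintro ⟨v, hv⟩
      refine ⟨fun x => v (ev.symm x), fun r => ?_⟩
      obtain ⟨x, hx⟩ := hv (er.symm r)
      exact ⟨ev x, by simpa [P, Q] using hx⟩
  -- a bound for the size of the circuit of one bit of the formula
  let n₀ := d * (q + 1) + d + q + 10
  have hconst : ∀ t : Bool, CircuitComputable n₀ {indicatorFun F fun _ : EVar k m → F => t} :=
    fun t => (CircuitComputable.empty.insert_const (bif t then 1 else 0)).mono
      (by simp only [n₀]; omega) (Set.singleton_subset_iff.2 (.inl rfl))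
  have hbit : ∀ i, CircuitComputable n₀ {indicatorFun F (W.get i)} := by
    intro i
    rcases mem_cnfWord (List.mem_reverse.1 (W.get_mem i)) with h | ⟨r, v, h | h⟩
    · rw [h]
      exact hconst true
    · rw [h]
      rcases posLit_eq_const_or (sameIndex e) (er.symm r) (ev.symm v) with
        ⟨t, ht⟩ | ⟨a, x, t, s, ht⟩
      · have : P r v = fun _ => t := funext fun X => ht _
        rw [this]
        exact hconst t
      · have : P r v = fun X => decide (Algebra.trace K F
            (t • (b a.2 * b (e x).2.2) * X (a.1, ((e x).1, (e x).2.1))) = s) := by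
          funext X
          rw [show P r v X = _ from ht _, traceCoeff, smul_mul_assoc, map_smul, smul_eq_mul]
        rw [this]
        exact CircuitComputable.trace_eq _ _ s
    · rw [h]
      exact hconst (negLit (sameIndex e) (er.symm r) (ev.symm v))
  obtain ⟨B, hB, hBW⟩ := hc W.length
  -- `B` accepts the zeros of `E`, so its output is negated
  have hzero := ((CircuitComputable.boolCircuit B W.get hbit).insert_const_mul
    (Set.mem_singleton _) (-1)).insert_const_add (.inl rfl) 1
  obtain ⟨C, hC, hCeval⟩ :=
    (hzero.mono le_rfl (Set.singleton_subset_iff.2 (.inl rfl))).exists_circuit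
  refine ⟨C, hC.trans ?_, fun X => ?_⟩
  · have h3 : D ≤ D ^ 3 := Nat.le_self_pow (by norm_num) D
    have h4 : D ≤ D ^ 4 := Nat.le_self_pow (by norm_num) D
    have hκ : Nat.card κ ≤ 6 * D ^ 4 := by
      refine (card_clause_le (sameIndex e)).trans ?_
      rw [Nat.card_prod, Nat.card_fin, Nat.card_fin]
      calc _ ≤ D ^ 4 + (D ^ 4 + ((D * D) * (D * D) + (D ^ 4 + (D * D ^ 3 +
            D * (D * (D * D)))))) :=
            Nat.add_le_add (hD.trans h4) <| Nat.add_le_add (hN.trans h4) <|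
            Nat.add_le_add (Nat.mul_le_mul (Nat.mul_le_mul hN hq) (Nat.mul_le_mul hN hq)) <|
            Nat.add_le_add (hA.trans h4) <|
            Nat.add_le_add (Nat.mul_le_mul hA (hq.trans h3)) <|
            Nat.mul_le_mul hA (Nat.mul_le_mul hN (Nat.mul_le_mul hq hq))
        _ = 6 * D ^ 4 := by ring
    have hV : Nat.card V ≤ 3 * D ^ 3 := by
      rw [card_var, Nat.card_prod, Nat.card_fin, Nat.card_fin]
      calc _ ≤ D * D ^ 2 + D * ((D + D) * D) :=
            Nat.add_le_add
              (Nat.mul_le_mul hN (hq.trans (Nat.le_self_pow (by norm_num) D)))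
              (Nat.mul_le_mul hA (Nat.mul_le_mul (Nat.add_le_add hN hD) hq))
        _ = 3 * D ^ 3 := by ring
    have hlen : W.length ≤ 48 * D ^ 7 := by
      simp only [W, List.length_reverse, length_cnfWord]
      calc _ ≤ 6 * D ^ 4 * (2 * (3 * D ^ 3) + 2 * D ^ 3) := by
            gcongr
            exact Nat.le_mul_of_pos_right _ (by positivity)
        _ = 48 * D ^ 7 := by ring
    have hn₀ : n₀ ≤ 20 * D ^ 2 := by
      have : d * q ≤ D * D := Nat.mul_le_mul hd hq
      have hd' : d ≤ D := hd
      have hq' : q ≤ D := hq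
      simp only [n₀]
      nlinarith
    have hs : B.size ≤ (48 * D ^ 7) ^ c + c := hB.trans (by gcongr)
    have : W.length * n₀ ≤ 48 * D ^ 7 * (20 * D ^ 2) := Nat.mul_le_mul hlen hn₀
    have e9 : 48 * D ^ 7 * (20 * D ^ 2) = 960 * D ^ 9 := by ring
    omega
  · rw [hCeval, map_pow]
    have hX := (hBW fun i => W.get i X).trans (hW X)
    have hF : 1 < Nat.card F := Finite.one_lt_card
    by_cases h : MvPolynomial.eval X (EPoly F k m) = 0
    · simp only [indicatorFun, hX.2 h, h]
      rw [zero_pow (by omega)]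
      simp
    · have h' : (B.eval fun i => W.get i X) = false := by
        rw [← Bool.not_eq_true]
        exact fun hB => h (hX.1 hB)
      have : Fintype F := Fintype.ofFinite F
      rw [Nat.card_eq_fintype_card, FiniteField.pow_card_sub_one_eq_one _ h]
      simp only [indicatorFun, h']
      simp

theorem proposition2p2 (k : ℕ) (hk : 3 ≤ k) (a : ℝ) (ha : 1 < a)
    (q : ℕ → ℕ) [hq : ∀ n, Fact (q n).Prime] (hq_poly : PolyBounded q)
    (hconj : StrongerConjecture k a q) :
    ¬ (NP ⊆ PPoly) := by
  intro hsub
  obtain ⟨c, hc⟩ := hsub cnfSat_mem_NP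
  have hn : ∀ m, 1 ≤ m → 0 < entryCount k m := fun m hm => by
    rw [entryCount]
    positivity
  have hl : ∀ m, 1 ≤ m → 0 < extDegree a (entryCount k m) := fun m hm =>
    extDegree_pos (by linarith) (hn m hm)
  -- the exponent `p - 1` turns `E` into an indicator function
  refine hconj (fun m => q (entryCount k m) ^ extDegree a (entryCount k m) - 1) (fun m hm => ?_) ?_
  · have : 1 < q (entryCount k m) ^ extDegree a (entryCount k m) :=
      Nat.one_lt_pow (hl m hm).ne' (hq _).out.one_lt
    omega
  -- a common bound for `k * m * l` and `q`; note that `k * m ≤ n`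
  let D : ℕ → ℕ := fun n => n * extDegree a n + extDegree a n + q n
  have hD : PolyBounded D :=
    (((PolyBounded.pow_self 1).mono (by simp)).mul (polyBounded_extDegree a (by linarith))).add
      (polyBounded_extDegree a (by linarith)) |>.add hq_poly
  have hbound : PolyBounded fun n => 1000 * D n ^ 9 + 4 * ((48 * D n ^ 7) ^ c + c) + 5 :=
    (((PolyBounded.const 1000).mul (hD.pow 9)).add ((PolyBounded.const 4).mul
      ((((PolyBounded.const 48).mul (hD.pow 7)).pow c).add (.const c)))).add (.const 5)
  obtain ⟨c', hc'⟩ := hbound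
  refine ⟨c', fun m hm => ?_⟩
  have hfin : Module.finrank (ZMod (q (entryCount k m)))
      (GaloisField (q (entryCount k m)) (extDegree a (entryCount k m))) =
      extDegree a (entryCount k m) := GaloisField.finrank _ (hl m hm).ne'
  have hcard := GaloisField.card (q (entryCount k m)) _ (hl m hm).ne'
  have hkm : k * m ≤ entryCount k m := by
    rw [entryCount]
    exact Nat.mul_le_mul_left _ (Nat.le_self_pow (by omega) m)
  have hm' : m ≤ entryCount k m := (Nat.le_mul_of_pos_left m (by omega)).trans hkm
  obtain ⟨C, hC, hcomp⟩ := exists_circuit_EPoly_pow (D := D (entryCount k m)) hc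
    (ZMod (q (entryCount k m)))
    (GaloisField (q (entryCount k m)) (extDegree a (entryCount k m))) (k := k) (m := m) (by omega)
    (by
      rw [hfin, ← mul_assoc]
      exact (Nat.mul_le_mul_right _ hkm).trans (by simp only [D]; omega))
    (by
      rw [hfin]
      exact (Nat.mul_le_mul_right _ hm').trans (by simp only [D]; omega))
    (by
      rw [hfin]
      simp only [D]; omega)
    (by
      rw [Nat.card_zmod]
      simp only [D]; omega)
  rw [hcard] at hcomp
  exact ⟨C, hC.trans (hc' _), hcomp⟩
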